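/- **Model.** A streaming Bernoulli bandit instance with $K$ arms is a sequence $\nu=(\mu_1,\dots,\mu_K)\in[0,1]^K$: the arms arrive one after another in this order, and each pull of the $i$-th arm returns an independent Bernoulli reward of mean $\mu_i$. A single-pass streaming algorithm with a memory of $m$ arms makes $T$ pulls. At any time it may pull the most recently arrived arm or one of at most $m$ stored arms, and it may read the next arm of the stream; an arm that is not stored when the next arm is read is lost for ever. Its decisions may depend on $K$, on $T$, on all rewards observed so far and on internal randomness. If $a_t$ denotes the arm pulled in trial $t$, its regret is $R_T=\sum_{t=1}^{T}\bigl(\max_i\mu_i-\mu_{a_t}\bigr)$. **Theorem.** There is an absolute constant $C>0$ such that for all integers $T\ge K\ge 2$ there is a finite family $\mathcal F_{K,T}$ of streaming Bernoulli bandit instances with $K$ arms, together with a probability distribution on $\mathcal F_{K,T}$, for which the following holds. For every (possibly randomized) single-pass streaming algorithm with a memory of at most $K/20$ arms, $$\mathbb E[R_T]\;\ge\; C\cdot K^{1/3}\,T^{2/3},$$ where the expectation is over the instance drawn from this distribution, the rewards and the internal randomness of the algorithm. The same bound holds if the arms of the drawn instance arrive in uniformly random order, the expectation being taken over the order as well.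 In particular, for every such algorithm some instance in $\mathcal F_{K,T}$ has expected regret at least $C\,K^{1/3}T^{2/3}$, and likewise some instance does in uniformly random order. -/

import Mathlib

namespace StreamingBandit

/-- A streaming Bernoulli bandit instance with `K` arms, listed in order of arrival: `ν i` is the
mean of the `i`-th arriving arm, and each pull of it returns an independent Bernoulli reward. -/
abbrev Instance (K : ℕ) : Type := Fin K → unitInterval

/-- A deterministic single-pass streaming algorithm for a stream of `K` arms with a memory of `m`
arms. All decisions are functions of the rewards observed so far (in chronological order).

When the next pull is made after the observations `h`:
* `pos h` is the arm read most recently from the stream (the arm in the arrival buffer);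
* `mem h` is the set of stored arms, kept in addition to the arrival buffer;
* `pull h` is the arm to be pulled, which is in the buffer or in the memory.

Between two pulls the algorithm may read any number of further arms. An arm can be in the memory
only if it was stored before or has been in the buffer since the preceding pull, so an arm that is
neither stored nor in the buffer is lost for ever. Only the number of stored arms is restricted,
the use of past observations is not. -/
structure StreamAlg (K m : ℕ) where
  pos : List Bool → Fin K
  mem : List Bool → Finset (Fin K)
  pull : List Bool → Fin K
  card_mem_le : ∀ h, (mem h).card ≤ m
  mem_nil : ∀ i ∈ mem [], i ≤ pos []
  pos_mono : ∀ h b, pos h ≤ pos (h ++ [b])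
  mem_step : ∀ h b, ∀ i ∈ mem (h ++ [b]), i ∈ mem h ∨ (pos h ≤ i ∧ i ≤ pos (h ++ [b]))
  pull_available : ∀ h, pull h = pos h ∨ pull h ∈ mem h

/-- A randomized single-pass streaming algorithm: a deterministic one chosen by a random seed
`ω : Ω` (drawn independently of the rewards). -/
structure RandomizedStreamAlg (K m : ℕ) (Ω : Type*) [MeasurableSpace Ω] where
  run : Ω → StreamAlg K m
  measurable_pull : ∀ h, Measurable fun ω => (run ω).pull h

/-- The probability that a Bernoulli arm of mean `p` returns the reward `b`. -/
def rewardProb (p : unitInterval) (b : Bool) : ℝ := if b then (p : ℝ) else 1 - (p : ℝ)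

/-- The mean of the best arm. -/
noncomputable def bestMean {K : ℕ} (ν : Instance K) : ℝ := ⨆ i, (ν i : ℝ)

variable {K m T : ℕ}

/-- The arm pulled by the algorithm in trial `t` when the sequence of rewards is `x`; it depends
only on the rewards of the earlier trials. -/
def StreamAlg.arm (A : StreamAlg K m) (x : Fin T → Bool) (t : Fin T) : Fin K :=
  A.pull ((List.ofFn x).take t)

/-- The probability that the rewards of the `T` trials are `x`. -/
noncomputable def StreamAlg.prob (A : StreamAlg K m) (ν : Instance K) (x : Fin T → Bool) : ℝ :=
  ∏ t, rewardProb (ν (A.arm x t)) (x t)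

/-- The regret `R_T` of the `T` trials when the rewards are `x`. -/
noncomputable def StreamAlg.regret (A : StreamAlg K m) (ν : Instance K) (x : Fin T → Bool) : ℝ :=
  ∑ t, (bestMean ν - (ν (A.arm x t) : ℝ))

/-- The expected regret of a deterministic algorithm over `T` trials. -/
noncomputable def StreamAlg.expectedRegret (A : StreamAlg K m) (ν : Instance K) (T : ℕ) : ℝ :=
  ∑ x : Fin T → Bool, A.prob ν x * A.regret ν x

/-- The expected regret of a randomized algorithm over `T` trials, the seed being drawn from `P`. -/
noncomputable def RandomizedStreamAlg.expectedRegret {Ω : Type*} [MeasurableSpace Ω]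
    (A : RandomizedStreamAlg K m Ω) (P : MeasureTheory.Measure Ω) (ν : Instance K) (T : ℕ) : ℝ :=
  ∫ ω, (A.run ω).expectedRegret ν T ∂P

/-- The expected regret when the arms of `ν` arrive in a uniformly random order (drawn
independently of the seed and the rewards). -/
noncomputable def RandomizedStreamAlg.expectedRegretRandomOrder {Ω : Type*} [MeasurableSpace Ω]
    (A : RandomizedStreamAlg K m Ω) (P : MeasureTheory.Measure Ω) (ν : Instance K) (T : ℕ) : ℝ :=
  (∑ σ : Equiv.Perm (Fin K), A.expectedRegret P (fun i => ν (σ i)) T) / (K.factorial : ℝ)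

end StreamingBandit

namespace StreamingBandit

/-! A spike is an instance of fair arms with one better arm. Put a spike of height `1 / 4` or `Δ` at
a uniform position and compare with all-fair rewards. Let `S` be the expected fair time before the
second half of the stream is reached. Until then a `1 / 4` spike in that half is unread, so each
such spike costs at least `S / 4` (`StreamAlg.timeBefore_le`). If `S` is small, few `Δ` spikes in
the first half can be recognised before that half is left, and afterwards only stored arms can be
pulled. `StreamAlg.likelihood_mul_pulls_le` makes this precise: pulls under the spike are bounded by
fair costs plus `T` times the divergence accumulated. Over all positions the divergence is charged
once per trial and at most `m` arms are stored (`StreamAlg.sum_detectionCost_le`), so most spikes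
lose order `T * Δ`. With `T * Δ ^ 3` of order `K` and threshold `T * Δ / 8` for `S`, either case
gives order `T * Δ`, that is `K ^ (1/3) * T ^ (2/3)`. -/

open MeasureTheory

/-! ### Expected costs on the tree of reward histories -/

section Tree

/-- The expected total cost of the next `n` trials after the history `h`, when a trial with history
`h` costs `c h` and its reward is `true` with probability `r h`. -/
noncomputable def expectedCost (r : List Bool → unitInterval) (c : List Bool → ℝ) :
    ℕ → List Bool → ℝ
  | 0, _ => 0
  | n + 1, h => c h + (r h : ℝ) * expectedCost r c n (h ++ [true])
      + (1 - (r h : ℝ)) * expectedCost r c n (h ++ [false])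

theorem sum_prob_eq_one (r : List Bool → unitInterval) (n : ℕ) (h : List Bool) :
    ∑ x : Fin n → Bool, ∏ t : Fin n, rewardProb (r (h ++ (List.ofFn x).take t)) (x t) = 1 := by
  induction n generalizing h with
  | zero => simp
  | succ n ih =>
    rw [← (Fin.consEquiv fun _ => Bool).sum_comp, Fintype.sum_prod_type]
    have key : ∀ b, ∑ y : Fin n → Bool, ∏ t : Fin n,
        rewardProb (r (h ++ b :: (List.ofFn y).take t)) (y t) = 1 := fun b => by
      simpa using ih (h ++ [b])
    simp only [Fin.consEquiv, Fin.prod_univ_succ, Equiv.coe_fn_mk, Fin.cons_zero, Fin.cons_succ,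
      Fin.val_zero, List.take_zero, List.append_nil, Fin.val_succ, List.ofFn_succ,
      List.take_succ_cons, ← Finset.mul_sum, key, Fintype.sum_bool]
    simp [rewardProb]

/-- Conditioning on the first reward turns sums over reward sequences into a recursion suited to
induction. -/
theorem sum_prob_mul_cost (r : List Bool → unitInterval) (c : List Bool → ℝ) (n : ℕ)
    (h : List Bool) :
    ∑ x : Fin n → Bool, (∏ t : Fin n, rewardProb (r (h ++ (List.ofFn x).take t)) (x t)) *
      ∑ t : Fin n, c (h ++ (List.ofFn x).take t) = expectedCost r c n h := by
  induction n generalizing h with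
  | zero => simp [expectedCost]
  | succ n ih =>
    rw [← (Fin.consEquiv fun _ => Bool).sum_comp, Fintype.sum_prod_type]
    have one : ∀ b, ∑ y : Fin n → Bool, ∏ t : Fin n,
        rewardProb (r (h ++ b :: (List.ofFn y).take t)) (y t) = 1 := fun b => by
      simpa using sum_prob_eq_one r n (h ++ [b])
    have key : ∀ b, ∑ y : Fin n → Bool, (∏ t : Fin n,
        rewardProb (r (h ++ b :: (List.ofFn y).take t)) (y t)) *
          ∑ t : Fin n, c (h ++ b :: (List.ofFn y).take t) = expectedCost r c n (h ++ [b]) :=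
      fun b => by simpa using ih (h ++ [b])
    simp only [Fin.consEquiv, Fin.prod_univ_succ, Fin.sum_univ_succ, Equiv.coe_fn_mk,
      Fin.cons_zero, Fin.cons_succ, Fin.val_zero, List.take_zero, List.append_nil, Fin.val_succ,
      List.ofFn_succ, List.take_succ_cons, mul_add, Finset.sum_add_distrib, ← Finset.sum_mul,
      mul_assoc, ← Finset.mul_sum, one, key, Fintype.sum_bool, expectedCost]
    simp only [rewardProb]
    norm_num
    ring

theorem expectedCost_nonneg {r : List Bool → unitInterval} {c : List Bool → ℝ}
    (hc : ∀ h, 0 ≤ c h) (n : ℕ) (h : List Bool) : 0 ≤ expectedCost r c n h := by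
  induction n generalizing h with
  | zero => simp [expectedCost]
  | succ n ih =>
    have h1 := mul_nonneg (r h).2.1 (ih (h ++ [true]))
    have h2 := mul_nonneg (sub_nonneg.2 (r h).2.2) (ih (h ++ [false]))
    have h3 := hc h
    simp only [expectedCost]
    linarith

theorem expectedCost_le {r : List Bool → unitInterval} {c : List Bool → ℝ}
    (hc : ∀ h, c h ≤ 1) (n : ℕ) (h : List Bool) : expectedCost r c n h ≤ n := by
  induction n generalizing h with
  | zero => simp [expectedCost]
  | succ n ih =>
    have h1 := mul_le_mul_of_nonneg_left (ih (h ++ [true])) (r h).2.1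
    have h2 := mul_le_mul_of_nonneg_left (ih (h ++ [false])) (sub_nonneg.2 (r h).2.2)
    have h3 := hc h
    simp only [expectedCost]
    push_cast
    linarith

theorem expectedCost_const_mul_one_sub (r : List Bool → unitInterval) (c : List Bool → ℝ) (ε : ℝ)
    (n : ℕ) (h : List Bool) :
    expectedCost r (fun h => ε * (1 - c h)) n h = ε * (n - expectedCost r c n h) := by
  induction n generalizing h with
  | zero => simp [expectedCost]
  | succ n ih =>
    simp only [expectedCost, ih]
    push_cast
    ring

/-- The expected cost of at most `n` further trials with fair rewards, when a trial with history
`h` costs `c h` as long as `act h` holds, and stopping with `n` trials left costs `s n h`. -/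
noncomputable def stoppedCost (act : List Bool → Prop) [DecidablePred act] (c : List Bool → ℝ)
    (s : ℕ → List Bool → ℝ) : ℕ → List Bool → ℝ
  | 0, _ => 0
  | n + 1, h =>
    if act h then
      c h + (stoppedCost act c s n (h ++ [true]) + stoppedCost act c s n (h ++ [false])) / 2
    else s (n + 1) h

end Tree

/-! ### Availability of arms and spiked instances -/

variable {K m : ℕ}

theorem StreamAlg.expectedRegret_eq_expectedCost (A : StreamAlg K m) (ν : Instance K) (T : ℕ) :
    A.expectedRegret ν T =
      expectedCost (fun h => ν (A.pull h)) (fun h => bestMean ν - (ν (A.pull h) : ℝ)) T [] := by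
  rw [← sum_prob_mul_cost]
  rfl

theorem StreamAlg.le_pos_of_mem (A : StreamAlg K m) (h : List Bool) :
    ∀ i ∈ A.mem h, i ≤ A.pos h := by
  induction h using List.reverseRecOn with
  | nil => exact A.mem_nil
  | append_singleton h b ih =>
    intro i hi
    rcases A.mem_step h b i hi with h1 | h1
    · exact (ih i h1).trans (A.pos_mono h b)
    · exact h1.2

theorem StreamAlg.pull_le_pos (A : StreamAlg K m) (h : List Bool) : A.pull h ≤ A.pos h := by
  rcases A.pull_available h with h1 | h1
  · exact h1.le
  · exact A.le_pos_of_mem h _ h1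

/-- An arm that has been passed and is not stored is never pulled again. -/
theorem StreamAlg.expectedCost_pull_eq_zero (A : StreamAlg K m) (r : List Bool → unitInterval)
    (p : Fin K) (n : ℕ) (h : List Bool) (hp : p < A.pos h) (hm : p ∉ A.mem h) :
    expectedCost r (fun h => if A.pull h = p then 1 else 0) n h = 0 := by
  induction n generalizing h with
  | zero => rfl
  | succ n ih =>
    have hpull : A.pull h ≠ p := by
      rintro rfl
      rcases A.pull_available h with h1 | h1
      · exact hp.ne h1
      · exact hm h1
    have step : ∀ b, expectedCost r (fun h => if A.pull h = p then 1 else 0) n (h ++ [b]) = 0 :=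
      fun b => ih _ (hp.trans_le (A.pos_mono h b)) fun hmem =>
        (A.mem_step h b p hmem).elim hm fun h1 => (hp.trans_le h1.1).false
    simp [expectedCost, hpull, step]

/-- All arms have mean `1 / 2`, except for the arm `p`, which has mean `1 / 2 + ε`. -/
noncomputable def spike (ε : ℝ) (p : Fin K) : Instance K :=
  fun i => if i = p then Set.projIcc 0 1 zero_le_one (1 / 2 + ε)
    else ⟨1 / 2, by norm_num, by norm_num⟩

theorem coe_spike {ε : ℝ} (h0 : 0 ≤ ε) (h1 : ε ≤ 1 / 2) (p i : Fin K) :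
    (spike ε p i : ℝ) = 1 / 2 + ε * if i = p then 1 else 0 := by
  unfold spike
  split_ifs
  · rw [Set.coe_projIcc, min_eq_right (by linarith), max_eq_right (by linarith), mul_one]
  · simp

theorem bestMean_spike {ε : ℝ} (h0 : 0 ≤ ε) (h1 : ε ≤ 1 / 2) (p : Fin K) :
    bestMean (spike ε p) = 1 / 2 + ε := by
  have : Nonempty (Fin K) := ⟨p⟩
  refine le_antisymm (ciSup_le fun i => ?_) ?_
  · rw [coe_spike h0 h1]
    split_ifs <;> linarith
  · refine le_ciSup_of_le (Set.finite_range _).bddAbove p ?_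
    simp [coe_spike h0 h1]

theorem spike_comp_perm (ε : ℝ) (p : Fin K) (σ : Equiv.Perm (Fin K)) :
    (fun i => spike ε p (σ i)) = spike ε (σ.symm p) := by
  funext i
  simp [spike, Equiv.eq_symm_apply]

theorem StreamAlg.expectedRegret_spike (A : StreamAlg K m) {ε : ℝ} (h0 : 0 ≤ ε) (h1 : ε ≤ 1 / 2)
    (p : Fin K) (T : ℕ) :
    A.expectedRegret (spike ε p) T = ε * (T - expectedCost (fun h => spike ε p (A.pull h))
      (fun h => if A.pull h = p then 1 else 0) T []) := by
  rw [A.expectedRegret_eq_expectedCost, ← expectedCost_const_mul_one_sub]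
  congr 1
  funext h
  rw [bestMean_spike h0 h1, coe_spike h0 h1]
  ring

/-- The expected number of trials, out of `n` trials with fair rewards after the history `h`, that
take place before an arm of index at least `k` is read. -/
noncomputable def StreamAlg.timeBefore (A : StreamAlg K m) (k : ℕ) : ℕ → List Bool → ℝ :=
  stoppedCost (fun h => (A.pos h : ℕ) < k) (fun _ => 1) (fun _ _ => 0)

theorem StreamAlg.timeBefore_nonneg (A : StreamAlg K m) (k n : ℕ) (h : List Bool) :
    0 ≤ A.timeBefore k n h := by
  induction n generalizing h with
  | zero => simp [timeBefore, stoppedCost]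
  | succ n ih =>
    have h1 := ih (h ++ [true])
    have h2 := ih (h ++ [false])
    simp only [timeBefore, stoppedCost] at *
    split_ifs <;> linarith

/-- The trials before a spike at `q ≥ k` is read are not pulls of `q`. -/
theorem StreamAlg.timeBefore_le (A : StreamAlg K m) {ε : ℝ} (h0 : 0 ≤ ε) (h1 : ε ≤ 1 / 2)
    {k : ℕ} {q : Fin K} (hq : k ≤ q) (n : ℕ) (h : List Bool) :
    A.timeBefore k n h ≤ n - expectedCost (fun h => spike ε q (A.pull h))
      (fun h => if A.pull h = q then 1 else 0) n h := by
  induction n generalizing h with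
  | zero => simp [timeBefore, stoppedCost, expectedCost]
  | succ n ih =>
    by_cases hact : (A.pos h : ℕ) < k
    -- The spike is still unread, so this reward is fair under both laws.
    · have hne : A.pull h ≠ q := by
        have := Fin.le_def.1 (A.pull_le_pos h)
        rintro rfl
        omega
      have ht := ih (h ++ [true])
      have hf := ih (h ++ [false])
      simp only [timeBefore] at ht hf ⊢
      simp only [stoppedCost, hact, expectedCost, hne, coe_spike h0 h1, if_true, if_false]
      push_cast
      linarith
    · have hle := expectedCost_le (r := fun h => spike ε q (A.pull h))
        (c := fun h => if A.pull h = q then 1 else 0) (fun h => by split_ifs <;> norm_num) (n + 1) h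
      simp only [timeBefore, stoppedCost, hact, if_false]
      linarith

/-! ### Change of measure -/

theorem le_two_add_two_mul_sub_log {L : ℝ} (hL : 0 < L) : L ≤ 2 + 2 * (L - 1 - Real.log L) := by
  have h1 := Real.log_le_sub_one_of_pos (half_pos hL)
  have h2 := Real.log_le_sub_one_of_pos (x := 2) two_pos
  rw [Real.log_div hL.ne' two_ne_zero] at h1
  linarith

/-- Removes the likelihood weight at the price of `L - 1 - log L`, whose fair mean is a divergence.
-/
theorem mul_le_two_mul_add_sub_log {L v w : ℝ} (hL : 0 < L) (hv : 0 ≤ v) (hvw : v ≤ w) :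
    L * v ≤ 2 * v + 2 * w * (L - 1 - Real.log L) := by
  have hφ : 0 ≤ L - 1 - Real.log L := by linarith [Real.log_le_sub_one_of_pos hL]
  nlinarith [mul_le_mul_of_nonneg_right (le_two_add_two_mul_sub_log hL) hv,
    mul_le_mul_of_nonneg_right hvw hφ]

/-- The Kullback-Leibler divergence of a fair Bernoulli variable from one of mean `1 / 2 + Δ`. -/
noncomputable def divergence (Δ : ℝ) : ℝ := -Real.log (1 - 4 * Δ ^ 2) / 2

theorem divergence_le {Δ : ℝ} (h0 : 0 ≤ Δ) (h1 : Δ ≤ 1 / 4) : divergence Δ ≤ 4 * Δ ^ 2 := by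
  have hy : 4 * Δ ^ 2 ≤ 1 / 4 := by nlinarith
  have hpos : 0 < 1 - 4 * Δ ^ 2 := by linarith
  have h2 := Real.one_sub_inv_le_log_of_pos hpos
  have h3 : (1 - 4 * Δ ^ 2)⁻¹ ≤ 1 + 8 * Δ ^ 2 := by
    rw [inv_le_iff_one_le_mul₀ hpos]
    nlinarith [sq_nonneg Δ]
  unfold divergence
  linarith

theorem divergence_nonneg {Δ : ℝ} (h0 : 0 ≤ Δ) (h1 : Δ ≤ 1 / 4) : 0 ≤ divergence Δ := by
  have h2 : Real.log (1 - 4 * Δ ^ 2) ≤ 0 := Real.log_nonpos (by nlinarith) (by nlinarith)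
  unfold divergence
  linarith

/-- A pull of the spike multiplies `L` by `1 ± 2 * Δ`: under fair rewards the mean of `L` is kept
and `-log L` gains one divergence. -/
theorem log_mul_add_log_mul {L Δ : ℝ} (hL : 0 < L) (h0 : 0 ≤ Δ) (h1 : Δ ≤ 1 / 4) :
    Real.log (L * (1 + 2 * Δ)) + Real.log (L * (1 - 2 * Δ))
      = 2 * Real.log L - 2 * divergence Δ := by
  have hp : 1 + 2 * Δ ≠ 0 := by linarith
  have hm : 1 - 2 * Δ ≠ 0 := by linarith
  rw [Real.log_mul hL.ne' hp, Real.log_mul hL.ne' hm]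
  have : Real.log (1 - 4 * Δ ^ 2) = Real.log (1 + 2 * Δ) + Real.log (1 - 2 * Δ) := by
    rw [← Real.log_mul hp hm]
    ring_nf
  unfold divergence
  linarith

/-- The fair-reward cost that controls the number of pulls of a spike `p` by change of measure. -/
noncomputable def StreamAlg.detectionCost (A : StreamAlg K m) (k T : ℕ) (Δ : ℝ) (p : Fin K) :
    ℕ → List Bool → ℝ :=
  stoppedCost (fun h => (A.pos h : ℕ) < k)
    (fun h => 2 + 2 * T * divergence Δ * if A.pull h = p then 1 else 0)
    (fun n h => 2 * n * if p ∈ A.mem h then 1 else 0)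

/-- Change of measure; `L` is the likelihood ratio of the history `h`. -/
theorem StreamAlg.likelihood_mul_pulls_le (A : StreamAlg K m) {Δ : ℝ} (h0 : 0 ≤ Δ)
    (h1 : Δ ≤ 1 / 4) {k T : ℕ} {p : Fin K} (hp : (p : ℕ) < k) (n : ℕ) (h : List Bool)
    (hT : h.length + n = T) (L : ℝ) (hL : 0 < L) :
    L * (h.length + expectedCost (fun h => spike Δ p (A.pull h))
      (fun h => if A.pull h = p then 1 else 0) n h) ≤
      2 * h.length + 2 * T * (L - 1 - Real.log L) + A.detectionCost k T Δ p n h := by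
  have hT' : (h.length : ℝ) + n = T := by exact_mod_cast hT
  have hlen : (0 : ℝ) ≤ h.length := Nat.cast_nonneg _
  have hn : (0 : ℝ) ≤ n := Nat.cast_nonneg _
  induction n generalizing h L with
  | zero =>
    have := mul_le_two_mul_add_sub_log hL hlen (by linarith : (h.length : ℝ) ≤ T)
    simpa [detectionCost, stoppedCost, expectedCost] using this
  | succ n ih =>
    by_cases hact : (A.pos h : ℕ) < k
    · have ih' : ∀ (b : Bool) (L : ℝ), 0 < L → _ := fun b L hL =>
        ih (h ++ [b]) (by simp; omega) L hL
          (by rw [← hT']; simp; ring) (Nat.cast_nonneg _) (Nat.cast_nonneg _)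
      simp only [List.length_append, List.length_singleton, Nat.cast_add, Nat.cast_one,
        detectionCost] at ih' ⊢
      by_cases hpull : A.pull h = p
      · have ht := ih' true (L * (1 + 2 * Δ)) (mul_pos hL (by linarith))
        have hf := ih' false (L * (1 - 2 * Δ)) (mul_pos hL (by linarith))
        have hlog := log_mul_add_log_mul hL h0 h1
        have hlog' := congrArg (fun z => (T : ℝ) * z) hlog
        simp only [stoppedCost, hact, expectedCost, hpull,
          coe_spike h0 (h1.trans (by norm_num)), if_true]
        linarith
      · have ht := ih' true L hL
        have hf := ih' false L hL
        simp only [stoppedCost, hact, expectedCost, hpull,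
          coe_spike h0 (h1.trans (by norm_num)), if_true, if_false]
        linarith
    · simp only [detectionCost, stoppedCost, hact, if_false]
      -- Past the first `k` arms, a stored spike may take all remaining trials, while an unstored
      -- one is lost.
      by_cases hmem : p ∈ A.mem h
      · have hc0 := expectedCost_nonneg (r := fun h => spike Δ p (A.pull h))
          (c := fun h => if A.pull h = p then 1 else 0)
          (fun h => by split_ifs <;> norm_num) (n + 1) h
        have hc1 := expectedCost_le (r := fun h => spike Δ p (A.pull h))
          (c := fun h => if A.pull h = p then 1 else 0)
          (fun h => by split_ifs <;> norm_num) (n + 1) h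
        have := mul_le_two_mul_add_sub_log hL (add_nonneg hlen hc0)
          (by linarith : _ ≤ (T : ℝ))
        simp only [hmem, if_true]
        linarith
      · rw [A.expectedCost_pull_eq_zero _ p _ h (Fin.lt_def.2 (by omega)) hmem]
        have := mul_le_two_mul_add_sub_log hL hlen (by linarith : (h.length : ℝ) ≤ T)
        simp only [hmem, if_false]
        linarith

/-- Each trial pulls a single arm, so its divergence is paid for only one `p`; on stopping, at most
`m` of the `p` are stored. -/
theorem StreamAlg.sum_detectionCost_le (A : StreamAlg K m) {Δ : ℝ} (h0 : 0 ≤ Δ)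
    (h1 : Δ ≤ 1 / 4) (k T : ℕ) (s : Finset (Fin K)) (n : ℕ) (h : List Bool) :
    ∑ p ∈ s, A.detectionCost k T Δ p n h ≤
      (2 * s.card + 2 * T * divergence Δ) * A.timeBefore k n h + 2 * n * m := by
  induction n generalizing h with
  | zero => simp [detectionCost, timeBefore, stoppedCost]
  | succ n ih =>
    by_cases hact : (A.pos h : ℕ) < k
    · have ht := ih (h ++ [true])
      have hf := ih (h ++ [false])
      have hd : (∑ p ∈ s, 2 * T * divergence Δ * if A.pull h = p then 1 else 0)
          ≤ 2 * T * divergence Δ := by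
        have := divergence_nonneg h0 h1
        rw [← Finset.mul_sum, Finset.sum_ite_eq]
        refine mul_le_of_le_one_right (by positivity) ?_
        split_ifs <;> norm_num
      simp only [detectionCost, timeBefore] at ht hf ⊢
      simp only [stoppedCost, hact, if_true, Finset.sum_add_distrib, ← Finset.sum_div,
        Finset.sum_const, nsmul_eq_mul]
      have : (0 : ℝ) ≤ m := Nat.cast_nonneg _
      push_cast
      linarith
    · have hc : (∑ p ∈ s, if p ∈ A.mem h then (1 : ℝ) else 0) ≤ m := by
        rw [Finset.sum_boole]
        refine Nat.cast_le.2 (le_trans (Finset.card_le_card fun i hi => ?_) (A.card_mem_le h))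
        exact (Finset.mem_filter.1 hi).2
      simp only [detectionCost, timeBefore, stoppedCost, hact, if_false, ← Finset.mul_sum,
        mul_zero, zero_add]
      exact mul_le_mul_of_nonneg_left hc (by positivity)

theorem StreamAlg.sum_pulls_le (A : StreamAlg K m) {Δ : ℝ} (h0 : 0 ≤ Δ)
    (h1 : Δ ≤ 1 / 4) (k T : ℕ) (s : Finset (Fin K)) (hs : ∀ p ∈ s, (p : ℕ) < k) :
    ∑ p ∈ s, expectedCost (fun h => spike Δ p (A.pull h))
      (fun h => if A.pull h = p then 1 else 0) T [] ≤
      (2 * s.card + 8 * T * Δ ^ 2) * A.timeBefore k T [] + 2 * T * m := by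
  calc _ ≤ ∑ p ∈ s, A.detectionCost k T Δ p T [] := Finset.sum_le_sum fun p hp => by
        simpa using A.likelihood_mul_pulls_le h0 h1 (hs p hp) T [] (by simp) 1 one_pos
    _ ≤ _ := A.sum_detectionCost_le h0 h1 k T s T []
    _ ≤ _ := by
      have h2 := divergence_le h0 h1
      have h3 := A.timeBefore_nonneg k T []
      gcongr ?_ * _ + _
      nlinarith [mul_le_mul_of_nonneg_left h2 (Nat.cast_nonneg (α := ℝ) T)]

/-! ### Averaging over spikes -/

theorem StreamAlg.expectedRegret_spike_nonneg (A : StreamAlg K m) {ε : ℝ} (h0 : 0 ≤ ε)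
    (h1 : ε ≤ 1 / 2) (p : Fin K) (T : ℕ) : 0 ≤ A.expectedRegret (spike ε p) T := by
  rw [A.expectedRegret_spike h0 h1]
  have := expectedCost_le (r := fun h => spike ε p (A.pull h))
    (c := fun h => if A.pull h = p then 1 else 0) (fun h => by split_ifs <;> norm_num) T []
  exact mul_nonneg h0 (by linarith)

/-- A deterministic algorithm with little memory has large regret on average over all the spikes of
heights `1 / 4` and `Δ`, where `T * Δ ^ 3 = K / 64`. -/
theorem StreamAlg.le_sum_expectedRegret (A : StreamAlg K m) {T : ℕ} {Δ : ℝ} (hK : 2 ≤ K)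
    (hm : (m : ℝ) ≤ K / 20) (h0 : 0 ≤ Δ) (h1 : Δ ≤ 1 / 4) (hΔ : T * Δ ^ 3 = K / 64) :
    T * Δ / 128 ≤ (∑ i : Bool × Fin K,
      A.expectedRegret (spike (if i.1 then 1 / 4 else Δ) i.2) T) / (2 * K) := by
  obtain ⟨k, hk⟩ : ∃ k, k = K / 2 := ⟨_, rfl⟩
  have hKpos : (0 : ℝ) < K := by exact_mod_cast (by omega : 0 < K)
  have hk3 : (K : ℝ) ≤ 3 * k := by exact_mod_cast (by omega : K ≤ 3 * k)
  have hk2 : 2 * (k : ℝ) ≤ K := by exact_mod_cast (by omega : 2 * k ≤ K)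
  set s : Finset (Fin K) := Finset.univ.filter fun p => (p : ℕ) < k with hs
  have hscard : s.card = k := by
    rw [hs, Fin.card_filter_val_lt]
    omega
  have hsccard : ((sᶜ).card : ℝ) = K - k := by
    rw [Finset.card_compl, hscard, Fintype.card_fin, Nat.cast_sub (by omega)]
  set S := A.timeBefore k T [] with hS
  have hT : (0 : ℝ) ≤ T := Nat.cast_nonneg _
  have hTΔ : 0 ≤ T * Δ := mul_nonneg hT h0
  have hlarge : (K - k) * (S / 4) ≤ ∑ q : Fin K, A.expectedRegret (spike (1 / 4) q) T :=
    calc (K - k) * (S / 4) = ∑ q ∈ sᶜ, S / 4 := by rw [Finset.sum_const, nsmul_eq_mul, hsccard]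
      _ ≤ ∑ q ∈ sᶜ, A.expectedRegret (spike (1 / 4) q) T := by
        refine Finset.sum_le_sum fun q hq => ?_
        have hkq : k ≤ q := by simpa [hs] using hq
        rw [A.expectedRegret_spike (by norm_num) (by norm_num)]
        linarith [A.timeBefore_le (ε := 1 / 4) (by norm_num) (by norm_num) hkq T []]
      _ ≤ _ := Finset.sum_le_univ_sum_of_nonneg fun q =>
        A.expectedRegret_spike_nonneg (by norm_num) (by norm_num) q T
  have hsmall : Δ * (k * T - ((2 * k + 8 * T * Δ ^ 2) * S + 2 * T * m)) ≤
      ∑ p : Fin K, A.expectedRegret (spike Δ p) T :=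
    calc _ ≤ ∑ p ∈ s, A.expectedRegret (spike Δ p) T := by
          simp_rw [A.expectedRegret_spike h0 (h1.trans (by norm_num : (1 : ℝ) / 4 ≤ 1 / 2))]
          rw [← Finset.mul_sum, Finset.sum_sub_distrib, Finset.sum_const, hscard, nsmul_eq_mul]
          have := A.sum_pulls_le h0 h1 k T s fun p hp => (Finset.mem_filter.1 hp).2
          rw [hscard] at this
          exact mul_le_mul_of_nonneg_left (by linarith) h0
      _ ≤ _ := Finset.sum_le_univ_sum_of_nonneg fun p =>
        A.expectedRegret_spike_nonneg h0 (by linarith) p T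
  rw [Fintype.sum_prod_type, Fintype.sum_bool, le_div_iff₀ (by positivity)]
  simp only [if_true, Bool.false_eq_true, if_false]
  -- A slow start is punished by the high spikes, a fast one by the low spikes.
  rcases le_total (T * Δ / 8) S with hc | hc
  · have hnn : 0 ≤ ∑ p : Fin K, A.expectedRegret (spike Δ p) T := Finset.sum_nonneg fun p _ =>
      A.expectedRegret_spike_nonneg h0 (by linarith) p T
    have : (K / 2 : ℝ) * (T * Δ / 8 / 4) ≤ (K - k) * (S / 4) := by
      gcongr <;> linarith
    linarith
  · have hnn : 0 ≤ ∑ q : Fin K, A.expectedRegret (spike (1 / 4) q) T := Finset.sum_nonneg fun q _ =>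
      A.expectedRegret_spike_nonneg (by norm_num) (by norm_num) q T
    have e1 : (2 * k + 8 * T * Δ ^ 2) * S ≤ (2 * k + 8 * T * Δ ^ 2) * (T * Δ / 8) := by gcongr
    have e2 : (2 * k + 8 * T * Δ ^ 2) * (T * Δ / 8) = k * T * Δ / 4 + T * (T * Δ ^ 3) := by ring
    have e3 : k * T * Δ ≤ k * T * (1 / 4) := by gcongr
    have e4 : (T : ℝ) * K ≤ T * (3 * k) := by gcongr
    have e5 : (T : ℝ) * m ≤ T * (K / 20) := by gcongr
    rw [hΔ] at e2
    -- In units of `k * T` the subtracted terms are at most `1/16 + 3/64 + 3/10 < 1/2`.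
    have e6 : (k : ℝ) * T / 2 ≤ k * T - ((2 * k + 8 * T * Δ ^ 2) * S + 2 * T * m) := by
      nlinarith [mul_nonneg hT (Nat.cast_nonneg (α := ℝ) k)]
    have e7 := mul_le_mul_of_nonneg_left e6 h0
    have e8 : (T * Δ) * K ≤ (T * Δ) * (3 * k) := by gcongr
    nlinarith

/-! ### Random seeds and random order -/

theorem RandomizedStreamAlg.integrable_expectedRegret {Ω : Type*} [MeasurableSpace Ω]
    (A : RandomizedStreamAlg K m Ω) (P : Measure Ω) [IsProbabilityMeasure P] (ν : Instance K)
    (T : ℕ) : Integrable (fun ω => (A.run ω).expectedRegret ν T) P := by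
  -- The seed matters only through the table of pulls, which has finitely many values.
  let g : ((Fin T → Bool) → Fin T → Fin K) → ℝ := fun a =>
    ∑ x : Fin T → Bool, (∏ t, rewardProb (ν (a x t)) (x t)) * ∑ t, (bestMean ν - (ν (a x t) : ℝ))
  have ha : Measurable fun ω => (A.run ω).arm (T := T) :=
    measurable_pi_lambda _ fun x => measurable_pi_lambda _ fun t => A.measurable_pull _
  have hg : Measurable g := Measurable.of_discrete
  refine Integrable.of_bound (C := ∑ a, ‖g a‖) (hg.comp ha).aestronglyMeasurable
    (ae_of_all _ fun ω => ?_)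
  exact Finset.single_le_sum (f := fun a => ‖g a‖) (fun _ _ => norm_nonneg _) (Finset.mem_univ _)

theorem RandomizedStreamAlg.le_sum_expectedRegret {Ω : Type*} [MeasurableSpace Ω]
    (A : RandomizedStreamAlg K m Ω) (P : Measure Ω) [IsProbabilityMeasure P] {T : ℕ} {Δ : ℝ}
    (hK : 2 ≤ K) (hm : (m : ℝ) ≤ K / 20) (h0 : 0 ≤ Δ) (h1 : Δ ≤ 1 / 4)
    (hΔ : T * Δ ^ 3 = K / 64) :
    T * Δ / 128 ≤ (∑ i : Bool × Fin K,
      A.expectedRegret P (spike (if i.1 then 1 / 4 else Δ) i.2) T) / (2 * K) := by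
  simp only [expectedRegret]
  rw [← integral_finsetSum _ fun i _ => A.integrable_expectedRegret P _ T, ← integral_div]
  calc T * Δ / 128 = ∫ _, T * Δ / 128 ∂P := by simp
    _ ≤ _ := integral_mono (integrable_const _)
      ((integrable_finsetSum _ fun i _ => A.integrable_expectedRegret P _ T).div_const _)
      fun ω => (A.run ω).le_sum_expectedRegret hK hm h0 h1 hΔ

/-- Reordering the arms only permutes the spikes of each height. -/
theorem RandomizedStreamAlg.sum_expectedRegretRandomOrder_spike {Ω : Type*} [MeasurableSpace Ω]
    (A : RandomizedStreamAlg K m Ω) (P : Measure Ω) (T : ℕ) (ε : Bool → ℝ) :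
    ∑ i : Bool × Fin K, A.expectedRegretRandomOrder P (spike (ε i.1) i.2) T =
      ∑ i : Bool × Fin K, A.expectedRegret P (spike (ε i.1) i.2) T := by
  simp only [expectedRegretRandomOrder, spike_comp_perm, Fintype.sum_prod_type]
  refine Finset.sum_congr rfl fun b _ => ?_
  rw [← Finset.sum_div, Finset.sum_comm]
  have : ∀ σ : Equiv.Perm (Fin K), ∑ p, A.expectedRegret P (spike (ε b) (σ.symm p)) T =
      ∑ p, A.expectedRegret P (spike (ε b) p) T := fun σ => 
    σ.symm.sum_comp fun p => A.expectedRegret P (spike (ε b) p) T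
  simp only [this, Finset.sum_const, Finset.card_univ, Fintype.card_perm, Fintype.card_fin,
    nsmul_eq_mul]
  field_simp

/-! ### The hard distribution -/

/-- The uniform distribution on a finite family of instances, listed with repetitions. -/
noncomputable def uniformWeight {ι : Type*} [Fintype ι] (inst : ι → Instance K)
    (ν : Instance K) : ℝ :=
  (∑ i, Set.indicator {inst i} 1 ν) / Fintype.card ι

theorem uniformWeight_nonneg {ι : Type*} [Fintype ι] (inst : ι → Instance K) (ν : Instance K) :
    0 ≤ uniformWeight inst ν :=
  div_nonneg (Finset.sum_nonneg fun _ _ => Set.indicator_nonneg (fun _ _ => zero_le_one) _)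
    (Nat.cast_nonneg _)

/-- Multiplicities matter: for `T = K` the two heights coincide. -/
theorem sum_uniformWeight_mul {ι : Type*} [Fintype ι] (inst : ι → Instance K)
    (F : Finset (Instance K)) (hF : ∀ i, inst i ∈ F) (g : Instance K → ℝ) :
    ∑ ν ∈ F, uniformWeight inst ν * g ν = (∑ i, g (inst i)) / Fintype.card ι := by
  classical
  simp only [uniformWeight, div_mul_eq_mul_div, ← Finset.sum_div, Finset.sum_mul]
  rw [Finset.sum_comm]
  congr 1
  refine Finset.sum_congr rfl fun i _ => ?_
  rw [Finset.sum_eq_single_of_mem (inst i) (hF i)]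
  · simp
  · intro ν _ hν
    simp [hν]

end StreamingBandit

/-- There is an absolute constant `C > 0` and, for all `T ≥ K ≥ 2`, a finite family `F` of
instances with a probability distribution `w` on it, on which every (possibly randomized)
single-pass algorithm with a memory of at most `K / 20` arms has expected regret at least
`C * K ^ (1/3) * T ^ (2/3)`, both in the given order of arrival and in uniformly random order. In
particular each of the two bounds holds for some member of the family. -/
theorem mainTheorem1 :
    ∃ C : ℝ, 0 < C ∧ ∀ K T : ℕ, 2 ≤ K → K ≤ T →
      ∃ (F : Finset (StreamingBandit.Instance K)) (w : StreamingBandit.Instance K → ℝ),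
        (∀ ν ∈ F, 0 ≤ w ν) ∧ ∑ ν ∈ F, w ν = 1 ∧
        ∀ (m : ℕ), (m : ℝ) ≤ (K : ℝ) / 20 →
        ∀ (Ω : Type*) [MeasurableSpace Ω] (P : MeasureTheory.Measure Ω)
          [MeasureTheory.IsProbabilityMeasure P]
          (A : StreamingBandit.RandomizedStreamAlg K m Ω),
          C * (K : ℝ) ^ (1 / 3 : ℝ) * (T : ℝ) ^ (2 / 3 : ℝ)
              ≤ ∑ ν ∈ F, w ν * A.expectedRegret P ν T ∧
          C * (K : ℝ) ^ (1 / 3 : ℝ) * (T : ℝ) ^ (2 / 3 : ℝ)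
              ≤ ∑ ν ∈ F, w ν * A.expectedRegretRandomOrder P ν T := by
  classical
  refine ⟨1 / 512, by norm_num, fun K T hK hKT => ?_⟩
  have hKpos : (0 : ℝ) < K := by exact_mod_cast (by omega : 0 < K)
  have hKT' : (K : ℝ) ≤ T := by exact_mod_cast hKT
  have hTpos : (0 : ℝ) < T := hKpos.trans_le hKT'
  -- Solves `T * Δ ^ 3 = K / 64`; the factor `1 / 4` ensures `Δ ≤ 1 / 4`, and `4 * 128 = 512` gives
  -- the constant.
  obtain ⟨Δ, hΔdef⟩ : ∃ Δ : ℝ, Δ = (K / T : ℝ) ^ (1 / 3 : ℝ) / 4 := ⟨_, rfl⟩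
  have h0 : 0 ≤ Δ := by rw [hΔdef]; positivity
  have h1 : Δ ≤ 1 / 4 := by
    rw [hΔdef]
    have := Real.rpow_le_one (z := 1 / 3) (by positivity : (0 : ℝ) ≤ K / T)
      ((div_le_one hTpos).2 hKT') (by norm_num)
    linarith
  have h3 : T * Δ ^ 3 = K / 64 := by
    rw [hΔdef, div_pow, ← Real.rpow_natCast ((K / T : ℝ) ^ (1 / 3 : ℝ)),
      ← Real.rpow_mul (by positivity)]
    norm_num
    field_simp
  have hbound : 1 / 512 * (K : ℝ) ^ (1 / 3 : ℝ) * (T : ℝ) ^ (2 / 3 : ℝ) = T * Δ / 128 := by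
    have : (T : ℝ) ^ (2 / 3 : ℝ) * (T : ℝ) ^ (1 / 3 : ℝ) = T := by
      rw [← Real.rpow_add hTpos]
      norm_num
    have hne : (T : ℝ) ^ (1 / 3 : ℝ) ≠ 0 := (Real.rpow_pos_of_pos hTpos _).ne'
    rw [hΔdef, Real.div_rpow hKpos.le hTpos.le]
    field_simp
    linear_combination 512 * this
  let inst : Bool × Fin K → StreamingBandit.Instance K := fun i =>
    StreamingBandit.spike (if i.1 then 1 / 4 else Δ) i.2
  have hF : ∀ i, inst i ∈ Finset.univ.image inst := fun i =>
    Finset.mem_image_of_mem _ (Finset.mem_univ _)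
  have hcard : (Fintype.card (Bool × Fin K) : ℝ) = 2 * K := by simp
  refine ⟨Finset.univ.image inst, StreamingBandit.uniformWeight inst,
    fun ν _ => StreamingBandit.uniformWeight_nonneg inst ν, ?_, ?_⟩
  · have := StreamingBandit.sum_uniformWeight_mul inst _ hF fun _ => 1
    simp only [mul_one] at this
    rw [this, Finset.sum_const, Finset.card_univ, nsmul_eq_mul, mul_one, hcard]
    exact div_self (by positivity)
  · intro m hm Ω _ P _ A
    have hle := A.le_sum_expectedRegret P hK hm h0 h1 h3
    rw [StreamingBandit.sum_uniformWeight_mul inst _ hF,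
      StreamingBandit.sum_uniformWeight_mul inst _ hF, hcard, hbound]
    exact ⟨hle, by
      rwa [A.sum_expectedRegretRandomOrder_spike P T fun b => if b then 1 / 4 else Δ]⟩
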